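/- Let $\mathfrak g$ be a nonabelian real Lie algebra of dimension $4$. For $\alpha\in\mathfrak g^*$ let $d\alpha(X,Y)=-\alpha([X,Y])$, call $\alpha$ closed if $d\alpha=0$, and let $\mathcal O(\alpha)\subset\mathfrak g^*$ be the coadjoint orbit of $\alpha$ (under a connected Lie group with Lie algebra $\mathfrak g$). Suppose that for every nonclosed linear form $\alpha\in\mathfrak g^*$ the orbit $\mathcal O(\alpha)$ has dimension $4$. Then there is a real number $\lambda<0$ such that $\mathfrak g$ is isomorphic to $\mathfrak g_4(\lambda)$, the $4$-dimensional real Lie algebra whose dual has a basis $\{\alpha_1,\alpha_2,\omega_1,\omega_2\}$ with the Maurer–Cartan equations $$d\alpha_1=d\alpha_2=0,\qquad d\omega_1=\alpha_1\wedge\omega_1+\alpha_2\wedge\omega_2,\qquad d\omega_2=\alpha_1\wedge\omega_2+\lambda\,\alpha_2\wedge\omega_1.$$ -/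

import Mathlib

/-! ### The exponential of an endomorphism, and the adjoint group -/

namespace CoadjointOrbits

open Module

section Exponential

variable {V : Type*} [AddCommGroup V] [Module ℝ V] [FiniteDimensional ℝ V]

/-- The exponential `∑ Aⁿ / n!` of an endomorphism `A` of a finite dimensional real vector space.
The algebra of endomorphisms carries its canonical (vector space) topology. -/
noncomputable def endExp (A : End ℝ V) : End ℝ V :=
  letI : TopologicalSpace (End ℝ V) := moduleTopology ℝ (End ℝ V)
  haveI : IsModuleTopology ℝ (End ℝ V) := ⟨rfl⟩
  haveI : IsTopologicalRing (End ℝ V) := IsModuleTopology.isTopologicalRing ℝ (End ℝ V)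
  NormedSpace.exp A

/-- In coordinates, `endExp` is the exponential of matrices. -/
theorem toMatrix_endExp {ι : Type*} [Fintype ι] [DecidableEq ι] (b : Basis ι ℝ V) (A : End ℝ V) :
    LinearMap.toMatrix b b (endExp A) = NormedSpace.exp (LinearMap.toMatrix b b A) := by
  let : TopologicalSpace (End ℝ V) := moduleTopology ℝ (End ℝ V)
  have : IsModuleTopology ℝ (End ℝ V) := ⟨rfl⟩
  have : IsTopologicalRing (End ℝ V) := IsModuleTopology.isTopologicalRing ℝ (End ℝ V)
  let e := LinearMap.toMatrixAlgEquiv b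
  have : ContinuousAdd (Matrix ι ι ℝ) := inferInstance
  have hc : Continuous e :=
    IsModuleTopology.continuous_of_linearMap (e.toLinearMap : End ℝ V →ₗ[ℝ] Matrix ι ι ℝ)
  have hc' : Continuous e.symm := by
    have : IsModuleTopology ℝ (Matrix ι ι ℝ) :=
      inferInstanceAs (IsModuleTopology ℝ (ι → ι → ℝ))
    exact IsModuleTopology.continuous_of_linearMap
      (e.symm.toLinearMap : Matrix ι ι ℝ →ₗ[ℝ] End ℝ V)
  let h : End ℝ V ≃ₜ Matrix ι ι ℝ := ⟨e.toEquiv, hc, hc'⟩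
  have : T2Space (End ℝ V) := h.symm.t2Space
  change e (NormedSpace.exp A) = NormedSpace.exp (e A)
  have hs : HasSum (fun n : ℕ => ((n.factorial : ℝ))⁻¹ • (e A) ^ n) (NormedSpace.exp (e A)) := by
    let : NormedRing (Matrix ι ι ℝ) := Matrix.linftyOpNormedRing
    let : NormedAlgebra ℝ (Matrix ι ι ℝ) := Matrix.linftyOpNormedAlgebra
    exact NormedSpace.exp_series_hasSum_exp' (𝕂 := ℝ) (e A)
  have hs' := hs.map e.symm hc'
  have key : NormedSpace.exp A = e.symm (NormedSpace.exp (e A)) := by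
    rw [NormedSpace.exp_eq_tsum ℝ, ← hs'.tsum_eq]
    refine tsum_congr fun n => ?_
    simp
  rw [key, AlgEquiv.apply_symm_apply]

theorem endExp_neg_mul (A : End ℝ V) : endExp (-A) * endExp A = 1 := by
  classical
  let b := Module.finBasis ℝ V
  apply (LinearMap.toMatrixAlgEquiv b).injective
  rw [map_mul, map_one]
  change LinearMap.toMatrix b b _ * LinearMap.toMatrix b b _ = 1
  rw [toMatrix_endExp, toMatrix_endExp, map_neg, Matrix.exp_neg]
  exact Matrix.nonsing_inv_mul _ ((Matrix.isUnit_iff_isUnit_det _).1 (Matrix.isUnit_exp _))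

end Exponential

section Orbits

variable {𝔤 : Type*} [LieRing 𝔤] [LieAlgebra ℝ 𝔤] [FiniteDimensional ℝ 𝔤]

/-- `Ad (exp X) = exp (ad X)`, as an invertible linear map of `𝔤`. -/
noncomputable def expAd (X : 𝔤) : 𝔤 ≃ₗ[ℝ] 𝔤 :=
  LinearEquiv.ofLinearMap (endExp (LieAlgebra.ad ℝ 𝔤 X)) (endExp (-LieAlgebra.ad ℝ 𝔤 X))
    (by simpa using! endExp_neg_mul (-LieAlgebra.ad ℝ 𝔤 X))
    (endExp_neg_mul (LieAlgebra.ad ℝ 𝔤 X))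

variable (𝔤) in
/-- The adjoint group of `𝔤`. It is the group `Ad G` for every connected Lie group `G` with Lie
algebra `𝔤`, as such a group is generated by the image of the exponential map. -/
def adjointGroup : Subgroup (𝔤 ≃ₗ[ℝ] 𝔤) :=
  Subgroup.closure (Set.range expAd)

/-- The coadjoint action: `⟨Ad* g α, X⟩ = ⟨α, Ad g⁻¹ X⟩`. -/
def coAd (g : 𝔤 ≃ₗ[ℝ] 𝔤) (α : Dual ℝ 𝔤) : Dual ℝ 𝔤 :=
  α ∘ₗ (g⁻¹ : 𝔤 ≃ₗ[ℝ] 𝔤).toLinearMap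

/-- The coadjoint orbit of the linear form `α`. -/
def coadjointOrbit (α : Dual ℝ 𝔤) : Set (Dual ℝ 𝔤) :=
  {β | ∃ g ∈ adjointGroup 𝔤, β = coAd g α}

/-- The tangent space at `β` of the coadjoint orbit through `β`, an orbit being an (immersed)
homogeneous manifold of the group: it is spanned by the velocities at `t = 0` of the curves
`t ↦ Ad* (exp tX) β` in the orbit, i.e. it is the image of the differential at the identity of the
orbit map of `β`. (The derivative in the finite dimensional space `𝔤*` is taken coordinatewise.) -/
def orbitTangentSpace (β : Dual ℝ 𝔤) : Submodule ℝ (Dual ℝ 𝔤) :=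
  Submodule.span ℝ
    {v | ∃ X : 𝔤, ∀ Y : 𝔤, HasDerivAt (fun t : ℝ => coAd (expAd (t • X)) β Y) (v Y) 0}

/-- The coadjoint orbit of `α` is a manifold of dimension `d`: all its tangent spaces have
dimension `d`. -/
def CoadjointOrbitHasDim (α : Dual ℝ 𝔤) (d : ℕ) : Prop :=
  ∀ β ∈ coadjointOrbit α, finrank ℝ (orbitTangentSpace β) = d

end Orbits

section Forms

variable {𝔤 : Type*} [LieRing 𝔤] [LieAlgebra ℝ 𝔤]

/-- The differential of a left invariant Pfaffian form: `dα(X, Y) = -α[X, Y]`. -/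
def formD (α : Dual ℝ 𝔤) : 𝔤 →ₗ[ℝ] 𝔤 →ₗ[ℝ] ℝ :=
  LinearMap.mk₂ ℝ (fun X Y => -α ⁅X, Y⁆)
    (fun X X' Y => by simp [add_comm]) (fun c X Y => by simp)
    (fun X Y Y' => by simp [add_comm]) (fun c X Y => by simp)

/-- A linear form is closed if its differential vanishes. -/
def IsClosedForm (α : Dual ℝ 𝔤) : Prop := formD α = 0

/-- The exterior product of two linear forms: `(α ∧ β)(X, Y) = α(X) β(Y) - α(Y) β(X)`. -/
def wedge (α β : Dual ℝ 𝔤) : 𝔤 →ₗ[ℝ] 𝔤 →ₗ[ℝ] ℝ :=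
  LinearMap.mk₂ ℝ (fun X Y => α X * β Y - α Y * β X)
    (fun X X' Y => by simp; ring) (fun c X Y => by simp; ring)
    (fun X Y Y' => by simp; ring) (fun c X Y => by simp; ring)

end Forms

/-! ### The Lie algebra `𝔤₄(λ)` -/

/-- The vector space underlying `𝔤₄(λ)`, with the coordinates `(α₁, α₂, ω₁, ω₂)`. -/
@[ext]
structure G4 (lam : ℝ) where
  a₁ : ℝ
  a₂ : ℝ
  w₁ : ℝ
  w₂ : ℝ

namespace G4

variable {lam : ℝ}

/-- The coordinates of an element. -/
def equivFun : G4 lam ≃ (Fin 4 → ℝ) where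
  toFun X := ![X.a₁, X.a₂, X.w₁, X.w₂]
  invFun v := ⟨v 0, v 1, v 2, v 3⟩
  left_inv _ := rfl
  right_inv v := by ext i; fin_cases i <;> rfl

instance : AddCommGroup (G4 lam) := equivFun.addCommGroup

noncomputable instance : Module ℝ (G4 lam) := equivFun.module ℝ

@[simp] theorem zero_a₁ : (0 : G4 lam).a₁ = 0 := rfl
@[simp] theorem zero_a₂ : (0 : G4 lam).a₂ = 0 := rfl
@[simp] theorem zero_w₁ : (0 : G4 lam).w₁ = 0 := rfl
@[simp] theorem zero_w₂ : (0 : G4 lam).w₂ = 0 := rfl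
@[simp] theorem add_a₁ (X Y : G4 lam) : (X + Y).a₁ = X.a₁ + Y.a₁ := rfl
@[simp] theorem add_a₂ (X Y : G4 lam) : (X + Y).a₂ = X.a₂ + Y.a₂ := rfl
@[simp] theorem add_w₁ (X Y : G4 lam) : (X + Y).w₁ = X.w₁ + Y.w₁ := rfl
@[simp] theorem add_w₂ (X Y : G4 lam) : (X + Y).w₂ = X.w₂ + Y.w₂ := rfl
@[simp] theorem smul_a₁ (c : ℝ) (X : G4 lam) : (c • X).a₁ = c * X.a₁ := rfl
@[simp] theorem smul_a₂ (c : ℝ) (X : G4 lam) : (c • X).a₂ = c * X.a₂ := rfl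
@[simp] theorem smul_w₁ (c : ℝ) (X : G4 lam) : (c • X).w₁ = c * X.w₁ := rfl
@[simp] theorem smul_w₂ (c : ℝ) (X : G4 lam) : (c • X).w₂ = c * X.w₂ := rfl

/-- The bracket that corresponds to the structure equations `maurerCartan` below. -/
instance : Bracket (G4 lam) (G4 lam) where
  bracket X Y :=
    { a₁ := 0
      a₂ := 0
      w₁ := -((X.a₁ * Y.w₁ - Y.a₁ * X.w₁) + (X.a₂ * Y.w₂ - Y.a₂ * X.w₂))
      w₂ := -((X.a₁ * Y.w₂ - Y.a₁ * X.w₂) + lam * (X.a₂ * Y.w₁ - Y.a₂ * X.w₁)) }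

@[simp] theorem lie_a₁ (X Y : G4 lam) : ⁅X, Y⁆.a₁ = 0 := rfl
@[simp] theorem lie_a₂ (X Y : G4 lam) : ⁅X, Y⁆.a₂ = 0 := rfl
@[simp] theorem lie_w₁ (X Y : G4 lam) : ⁅X, Y⁆.w₁ =
    -((X.a₁ * Y.w₁ - Y.a₁ * X.w₁) + (X.a₂ * Y.w₂ - Y.a₂ * X.w₂)) := rfl
@[simp] theorem lie_w₂ (X Y : G4 lam) : ⁅X, Y⁆.w₂ =
    -((X.a₁ * Y.w₂ - Y.a₁ * X.w₂) + lam * (X.a₂ * Y.w₁ - Y.a₂ * X.w₁)) := rfl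

instance : LieRing (G4 lam) where
  add_lie X Y Z := by ext <;> simp <;> ring
  lie_add X Y Z := by ext <;> simp <;> ring
  lie_self X := by ext <;> simp
  leibniz_lie X Y Z := by ext <;> simp <;> ring

noncomputable instance : LieAlgebra ℝ (G4 lam) where
  lie_smul c X Y := by ext <;> simp <;> ring

variable (lam) in
/-- `α₁`; the forms `α₁, α₂, ω₁, ω₂` are the dual basis of the standard basis of `𝔤₄(λ)`. -/
def alpha₁ : Dual ℝ (G4 lam) := ⟨⟨a₁, add_a₁⟩, smul_a₁⟩

variable (lam) in
def alpha₂ : Dual ℝ (G4 lam) := ⟨⟨a₂, add_a₂⟩, smul_a₂⟩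

variable (lam) in
def omega₁ : Dual ℝ (G4 lam) := ⟨⟨w₁, add_w₁⟩, smul_w₁⟩

variable (lam) in
def omega₂ : Dual ℝ (G4 lam) := ⟨⟨w₂, add_w₂⟩, smul_w₂⟩

/-- The Maurer-Cartan equations of `𝔤₄(λ)`. -/
theorem maurerCartan :
    formD (alpha₁ lam) = 0 ∧ formD (alpha₂ lam) = 0 ∧
    formD (omega₁ lam) = wedge (alpha₁ lam) (omega₁ lam) + wedge (alpha₂ lam) (omega₂ lam) ∧
    formD (omega₂ lam) =
      wedge (alpha₁ lam) (omega₂ lam) + lam • wedge (alpha₂ lam) (omega₁ lam) := by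
  refine ⟨?_, ?_, ?_, ?_⟩ <;> refine LinearMap.ext₂ fun X Y => ?_ <;>
    simp [formD, wedge, alpha₁, alpha₂, omega₁, omega₂]

end G4

end CoadjointOrbits

/-! The tangent space of the orbit at `α` lies in the range of `kirillovMap α`, so the form `α ⁅X,
Y⁆` is nondegenerate for every nonclosed `α`. Hence all `ad X` with `X ≠ 0` have the same range `D`,
the derived algebra (`range_ad_le_range_ad`), and `dim D` is 1, 2 or 3.

An element `P` with `α ∘ ad P = α` has `tr (ad P) = 2` (`two_mul_trace_ad`), whereas the trace would
be 1 if `dim D = 1` and 0 if `dim D = 3`. If `dim D = 2`, then `D` is abelian, some `E` acts on it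
as the identity, and some `A` commuting with `E` acts on it with square `λ`. If `λ ≥ 0`, a real
eigenvector of `A` in `D` would have too large a centralizer. -/

namespace CoadjointOrbits

open Module

/-! ### Kirillov form and tangent spaces of orbits -/

section Kirillov

variable {𝔤 : Type*} [LieRing 𝔤] [LieAlgebra ℝ 𝔤]

/-- The Kirillov form `(X, Y) ↦ α[X, Y]`, as a map from `𝔤` to its dual. -/
def kirillovMap (α : Dual ℝ 𝔤) : 𝔤 →ₗ[ℝ] Dual ℝ 𝔤 :=
  LinearMap.compr₂ (LieAlgebra.ad ℝ 𝔤 : 𝔤 →ₗ[ℝ] End ℝ 𝔤) α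

@[simp] theorem kirillovMap_apply (α : Dual ℝ 𝔤) (X Y : 𝔤) : kirillovMap α X Y = α ⁅X, Y⁆ := rfl

end Kirillov

section Tangent

variable {V : Type*} [AddCommGroup V] [Module ℝ V] [FiniteDimensional ℝ V]

theorem hasDerivAt_endExp_smul (A : End ℝ V) (β : Dual ℝ V) (Y : V) :
    HasDerivAt (fun t : ℝ => β (endExp (t • A) Y)) (β (A Y)) 0 := by
  let b := Module.finBasis ℝ V
  let L : Matrix (Fin (finrank ℝ V)) (Fin (finrank ℝ V)) ℝ →ₗ[ℝ] ℝ :=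
    β ∘ₗ LinearMap.applyₗ Y ∘ₗ (LinearMap.toMatrix b b).symm.toLinearMap
  let : NormedRing (Matrix (Fin (finrank ℝ V)) (Fin (finrank ℝ V)) ℝ) := Matrix.linftyOpNormedRing
  let : NormedAlgebra ℝ (Matrix (Fin (finrank ℝ V)) (Fin (finrank ℝ V)) ℝ) :=
    Matrix.linftyOpNormedAlgebra
  have h := hasDerivAt_exp_smul_const (𝕂 := ℝ) (LinearMap.toMatrix b b A) (0 : ℝ)
  have h' := (LinearMap.toContinuousLinearMap L).hasFDerivAt.comp_hasDerivAt (0 : ℝ) h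
  have e1 : ∀ t : ℝ, β (endExp (t • A) Y) =
      L (NormedSpace.exp (t • LinearMap.toMatrix b b A)) := by
    intro t
    rw [← map_smul, ← toMatrix_endExp]
    simp [L]
  have e2 : β (A Y) = L (LinearMap.toMatrix b b A) := by simp [L]
  simp only [e1, e2]
  simpa using! h'

variable {𝔤 : Type*} [LieRing 𝔤] [LieAlgebra ℝ 𝔤] [FiniteDimensional ℝ 𝔤]

theorem orbitTangentSpace_le (α : Dual ℝ 𝔤) :
    orbitTangentSpace α ≤ LinearMap.range (kirillovMap α) := by
  refine Submodule.span_le.2 ?_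
  rintro v ⟨X, hX⟩
  -- The sign comes from the inverse in the coadjoint action.
  refine ⟨-X, LinearMap.ext fun Y => ?_⟩
  have h : HasDerivAt (fun t : ℝ => coAd (expAd (t • X)) α Y) (α ((-LieAlgebra.ad ℝ 𝔤 X) Y)) 0 := by
    have e : ∀ t : ℝ, coAd (expAd (t • X)) α Y = α (endExp (t • -LieAlgebra.ad ℝ 𝔤 X) Y) := by
      intro t
      rw [smul_neg, ← map_smul]
      rfl
    simp only [e]
    exact hasDerivAt_endExp_smul _ _ _
  rw [← h.unique (hX Y), map_neg, LinearMap.neg_apply, LinearMap.neg_apply, map_neg]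
  rfl

theorem kirillovMap_bijective {α : Dual ℝ 𝔤} (h : CoadjointOrbitHasDim α (finrank ℝ 𝔤)) :
    Function.Bijective (kirillovMap α) := by
  have hd := h α ⟨1, one_mem _, LinearMap.ext fun _ => rfl⟩
  have h1 := Submodule.finrank_mono (orbitTangentSpace_le α)
  have hs : Function.Surjective (kirillovMap α) := by
    rw [← LinearMap.range_eq_top]
    apply Submodule.eq_top_of_finrank_eq
    have := Submodule.finrank_le (LinearMap.range (kirillovMap α))
    rw [Subspace.dual_finrank_eq] at *
    omega
  exact ⟨(LinearMap.injective_iff_surjective_of_finrank_eq_finrank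
    (Subspace.dual_finrank_eq).symm).2 hs, hs⟩

end Tangent

/-! ### Ranges and traces of `ad`, and the model algebra -/

section Structure

variable {𝔤 : Type*} [LieRing 𝔤] [LieAlgebra ℝ 𝔤]

theorem isClosedForm_iff {α : Dual ℝ 𝔤} : IsClosedForm α ↔ ∀ X Y : 𝔤, α ⁅X, Y⁆ = 0 := by
  simp [IsClosedForm, formD, LinearMap.ext_iff]

/-- If the range of `ad X` missed some `⁅Y, Z⁆`, a form vanishing on that range but not at `⁅Y, Z⁆`
would be nonclosed with `X` in the radical of its Kirillov form. -/
theorem range_ad_le_range_ad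
    (h : ∀ α : Dual ℝ 𝔤, ¬ IsClosedForm α → Function.Injective (kirillovMap α))
    {X : 𝔤} (hX : X ≠ 0) (Y : 𝔤) :
    LinearMap.range (LieAlgebra.ad ℝ 𝔤 Y) ≤ LinearMap.range (LieAlgebra.ad ℝ 𝔤 X) := by
  rintro _ ⟨Z, rfl⟩
  by_contra hZ
  obtain ⟨α, hα, hle⟩ := Submodule.exists_le_ker_of_notMem hZ
  have hc : ¬ IsClosedForm α := fun hc => hα (isClosedForm_iff.1 hc Y Z)
  refine hX (h α hc ?_)
  rw [map_zero]
  exact LinearMap.ext fun W => hle ⟨W, rfl⟩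

/-- The trace of a principal element of a Frobenius Lie algebra. -/
theorem two_mul_trace_ad [FiniteDimensional ℝ 𝔤] {α : Dual ℝ 𝔤}
    (h : Function.Bijective (kirillovMap α)) {X : 𝔤} (hX : kirillovMap α X = α) :
    2 * LinearMap.trace ℝ 𝔤 (LieAlgebra.ad ℝ 𝔤 X) = finrank ℝ 𝔤 := by
  let B := LinearEquiv.ofBijective _ h
  -- This is the Jacobi identity under `α`; taking traces gives `t = n - t`.
  have hM : B.conj (LieAlgebra.ad ℝ 𝔤 X) = 1 - Dual.transpose (LieAlgebra.ad ℝ 𝔤 X) := by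
    refine LinearMap.ext fun β => ?_
    obtain ⟨U, rfl⟩ := B.surjective β
    refine LinearMap.ext fun V => ?_
    have h1 : α ⁅X, ⁅U, V⁆⁆ = α ⁅U, V⁆ := LinearMap.congr_fun hX ⁅U, V⁆
    rw [leibniz_lie, map_add] at h1
    have h2 : B.conj (LieAlgebra.ad ℝ 𝔤 X) (B U) V = α ⁅⁅X, U⁆, V⁆ := by
      rw [LinearEquiv.conj_apply_apply, LinearEquiv.symm_apply_apply]
      rfl
    have h3 : (1 - Dual.transpose (LieAlgebra.ad ℝ 𝔤 X) : End ℝ (Dual ℝ 𝔤)) (B U) V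
        = α ⁅U, V⁆ - α ⁅U, ⁅X, V⁆⁆ := rfl
    rw [h2, h3]
    linarith
  have ht := congrArg (LinearMap.trace ℝ _) hM
  rw [LinearMap.trace_conj'] at ht
  have ht' := ht.trans (map_sub (LinearMap.trace ℝ (Dual ℝ 𝔤)) 1 _)
  rw [LinearMap.trace_one, Subspace.dual_finrank_eq, LinearMap.trace_transpose'] at ht'
  linarith

theorem exists_eq_smul_of_lie_eq_zero [FiniteDimensional ℝ 𝔤] {U V : 𝔤} (hU : U ≠ 0)
    (hr : finrank ℝ (LinearMap.range (LieAlgebra.ad ℝ 𝔤 U)) + 1 = finrank ℝ 𝔤)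
    (h : ⁅U, V⁆ = 0) : ∃ c : ℝ, V = c • U := by
  have hk := LinearMap.finrank_range_add_finrank_ker (LieAlgebra.ad ℝ 𝔤 U)
  have h1 : finrank ℝ (LinearMap.ker (LieAlgebra.ad ℝ 𝔤 U)) = 1 := by omega
  have hu : (⟨U, by simp⟩ : LinearMap.ker (LieAlgebra.ad ℝ 𝔤 U)) ≠ 0 := by
    simpa using hU
  obtain ⟨c, hc⟩ := (finrank_eq_one_iff_of_nonzero' _ hu).1 h1 ⟨V, by simpa using h⟩
  exact ⟨c, by simpa using (congrArg Subtype.val hc).symm⟩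

/-- Bivectors in three-space are decomposable: `a` times the combination is the single bracket `⁅a •
y - b • x, a • z - c • x⁆`, whose entries are independent if `a ≠ 0`. -/
theorem lie_combination_ne_zero (h : ∀ U V : 𝔤, U ≠ 0 → ⁅U, V⁆ = 0 → ∃ c : ℝ, V = c • U)
    {x y z : 𝔤} (hli : ∀ p q r : ℝ, p • x + q • y + r • z = 0 → p = 0 ∧ q = 0 ∧ r = 0)
    {a b c : ℝ} (h0 : a • ⁅y, z⁆ + b • ⁅z, x⁆ + c • ⁅x, y⁆ = 0) : a = 0 := by
  by_contra ha
  have hU : a • y - b • x ≠ 0 := fun hU => ha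
    (hli (-b) a 0 (by rw [← hU]; module)).2.1
  obtain ⟨k, hk⟩ := h (a • y - b • x) (a • z - c • x) hU (by
    have : ⁅a • y - b • x, a • z - c • x⁆ = a • (a • ⁅y, z⁆ + b • ⁅z, x⁆ + c • ⁅x, y⁆) := by
      simp only [sub_lie, lie_sub, smul_lie, lie_smul, lie_self]
      rw [← lie_skew x z, ← lie_skew y x]
      module
    rw [this, h0, smul_zero])
  refine ha (hli (k * b - c) (-(k * a)) a ?_).2.2
  rw [← sub_eq_zero] at hk
  rw [← hk]
  module

/-- An operator that acts as a derivation on a three-dimensional algebra whose bracket identifies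
bivectors with vectors is traceless. -/
theorem trace_eq_zero_of_derivation {D : Type*} [LieRing D] [LieAlgebra ℝ D]
    (δ : D →ₗ[ℝ] D) (hδ : ∀ U V : D, δ ⁅U, V⁆ = ⁅δ U, V⁆ + ⁅U, δ V⁆)
    (e : Basis (Fin 3) ℝ D) (h : ∀ U V : D, U ≠ 0 → ⁅U, V⁆ = 0 → ∃ c : ℝ, V = c • U) :
    LinearMap.trace ℝ D δ = 0 := by
  have he := Fintype.linearIndependent_iff.1 e.linearIndependent
  have hli : ∀ p q r : ℝ, p • e 0 + q • e 1 + r • e 2 = 0 → p = 0 ∧ q = 0 ∧ r = 0 := by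
    intro p q r hs
    have := he ![p, q, r] (by simpa [Fin.sum_univ_three] using hs)
    exact ⟨this 0, this 1, this 2⟩
  -- The brackets form a second basis, on which `δ` acts as on bivectors, with trace `2 tr δ`;
  -- comparing the two bases gives `tr δ = 2 tr δ`.
  have hf : LinearIndependent ℝ ![⁅e 1, e 2⁆, ⁅e 2, e 0⁆, ⁅e 0, e 1⁆] := by
    refine Fintype.linearIndependent_iff.2 fun g hg => ?_
    simp only [Fin.sum_univ_three, Matrix.cons_val] at hg
    have h0 : g 0 = 0 := lie_combination_ne_zero h hli hg
    have h1 : g 1 = 0 := by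
      refine lie_combination_ne_zero h (x := e 1) (y := e 2) (z := e 0) (b := g 2) (c := g 0)
        (fun p q r hs => ?_) (by rw [← hg]; abel)
      obtain ⟨h1, h2, h3⟩ := hli r p q (by rw [← hs]; abel)
      exact ⟨h2, h3, h1⟩
    have h2 : g 2 = 0 := by
      refine lie_combination_ne_zero h (x := e 2) (y := e 0) (z := e 1) (b := g 0) (c := g 1)
        (fun p q r hs => ?_) (by rw [← hg]; abel)
      obtain ⟨h1, h2, h3⟩ := hli q r p (by rw [← hs]; abel)
      exact ⟨h3, h1, h2⟩
    intro i
    fin_cases i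
    exacts [h0, h1, h2]
  have hcard : Fintype.card (Fin 3) = finrank ℝ D := (finrank_eq_card_basis e).symm
  let f := basisOfLinearIndependentOfCardEqFinrank hf hcard
  have f0 : f 0 = ⁅e 1, e 2⁆ := by simp [f]
  have f1 : f 1 = ⁅e 2, e 0⁆ := by simp [f]
  have f2 : f 2 = ⁅e 0, e 1⁆ := by simp [f]
  have hde : ∀ j, δ (e j) = e.repr (δ (e j)) 0 • e 0 + e.repr (δ (e j)) 1 • e 1 +
      e.repr (δ (e j)) 2 • e 2 := fun j => by
    conv_lhs => rw [← e.sum_repr (δ (e j)), Fin.sum_univ_three]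
  have te := LinearMap.trace_eq_matrix_trace ℝ e δ
  have tf := LinearMap.trace_eq_matrix_trace ℝ f δ
  simp only [Matrix.trace, Matrix.diag, LinearMap.toMatrix_apply, Fin.sum_univ_three] at te tf
  have cyc : ∀ j k : Fin 3, δ ⁅e j, e k⁆ =
      (e.repr (δ (e j)) 0 • ⁅e 0, e k⁆ + e.repr (δ (e j)) 1 • ⁅e 1, e k⁆ +
      e.repr (δ (e j)) 2 • ⁅e 2, e k⁆) + (e.repr (δ (e k)) 0 • ⁅e j, e 0⁆ +
      e.repr (δ (e k)) 1 • ⁅e j, e 1⁆ + e.repr (δ (e k)) 2 • ⁅e j, e 2⁆) := by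
    intro j k
    rw [hδ]
    conv_lhs => rw [hde j, hde k]
    simp only [add_lie, lie_add, smul_lie, lie_smul]
  have s0 : ⁅e 2, e 1⁆ = -f 0 := by rw [f0, lie_skew]
  have s1 : ⁅e 0, e 2⁆ = -f 1 := by rw [f1, lie_skew]
  have s2 : ⁅e 1, e 0⁆ = -f 2 := by rw [f2, lie_skew]
  have g0 : f.repr (δ (f 0)) 0 = e.repr (δ (e 1)) 1 + e.repr (δ (e 2)) 2 := by
    rw [f0, cyc]
    simp [s1, s2, ← f0]
  have g1 : f.repr (δ (f 1)) 1 = e.repr (δ (e 2)) 2 + e.repr (δ (e 0)) 0 := by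
    rw [f1, cyc]
    simp [s0, s2, ← f1]
  have g2 : f.repr (δ (f 2)) 2 = e.repr (δ (e 0)) 0 + e.repr (δ (e 1)) 1 := by
    rw [f2, cyc]
    simp [s0, s1, ← f2]
  rw [g0, g1, g2] at tf
  linarith

/-- The algebra `𝔤₄(λ)` is recognized by a basis with its brackets. -/
theorem nonempty_lieEquiv_G4 [FiniteDimensional ℝ 𝔤] (hdim : finrank ℝ 𝔤 = 4) {lam : ℝ}
    {E A W Z : 𝔤} (hEA : ⁅E, A⁆ = 0) (hEW : ⁅E, W⁆ = W) (hEZ : ⁅E, Z⁆ = Z)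
    (hAW : ⁅A, W⁆ = lam • Z) (hAZ : ⁅A, Z⁆ = W) (hWZ : ⁅W, Z⁆ = 0)
    (hli : ∀ p q : ℝ, p • Z + q • W = 0 → p = 0 ∧ q = 0) :
    Nonempty (𝔤 ≃ₗ⁅ℝ⁆ G4 lam) := by
  have hAE : ⁅A, E⁆ = 0 := by rw [← lie_skew, hEA, neg_zero]
  have hWE : ⁅W, E⁆ = -W := by rw [← lie_skew, hEW]
  have hZE : ⁅Z, E⁆ = -Z := by rw [← lie_skew, hEZ]
  have hWA : ⁅W, A⁆ = -(lam • Z) := by rw [← lie_skew, hAW]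
  have hZA : ⁅Z, A⁆ = -W := by rw [← lie_skew, hAZ]
  have hZW : ⁅Z, W⁆ = 0 := by rw [← lie_skew, hWZ, neg_zero]
  -- The signs of `E` and `A` absorb the one in `dα(X, Y) = -α ⁅X, Y⁆`.
  let f : G4 lam →ₗ⁅ℝ⁆ 𝔤 :=
    { toFun := fun X => -X.a₁ • E - X.a₂ • A + X.w₁ • W + X.w₂ • Z
      map_add' := fun X Y => by simp only [G4.add_a₁, G4.add_a₂, G4.add_w₁, G4.add_w₂]; module
      map_smul' := fun c X => by
        simp only [G4.smul_a₁, G4.smul_a₂, G4.smul_w₁, G4.smul_w₂, RingHom.id_apply]; module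
      map_lie' := fun {X Y} => by
        simp only [G4.lie_a₁, G4.lie_a₂, G4.lie_w₁, G4.lie_w₂, add_lie, lie_add, sub_lie, lie_sub,
          smul_lie, lie_smul, lie_self, hEA, hEW, hEZ, hAW, hAZ, hWZ, hAE, hWE, hZE, hWA, hZA, hZW]
        module }
  have hf : ∀ X, f X = -X.a₁ • E - X.a₂ • A + X.w₁ • W + X.w₂ • Z := fun _ => rfl
  have hinj : Function.Injective f := by
    refine (injective_iff_map_eq_zero f).2 fun X hX => ?_
    rw [hf] at hX
    -- Bracketing with `Z` kills the `W` and `Z` terms and isolates `a₁`, `a₂`.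
    have h1 := congrArg (fun T => ⁅T, Z⁆) hX
    simp only [add_lie, sub_lie, smul_lie, hEZ, hAZ, hWZ, lie_self, zero_lie, smul_zero,
      add_zero] at h1
    obtain ⟨ha, hb⟩ := hli (-X.a₁) (-X.a₂) (by rw [← h1]; module)
    rw [neg_eq_zero] at ha hb
    rw [ha, hb] at hX
    obtain ⟨hz, hw⟩ := hli X.w₂ X.w₁ (by rw [← hX]; module)
    exact G4.ext ha hb hw hz
  let e4 : G4 lam ≃ₗ[ℝ] (Fin 4 → ℝ) := G4.equivFun.linearEquiv ℝ
  have : FiniteDimensional ℝ (G4 lam) := e4.symm.finiteDimensional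
  have hd : finrank ℝ (G4 lam) = finrank ℝ 𝔤 := by rw [e4.finrank_eq, hdim]; simp
  have hsurj : Function.Surjective (f : G4 lam →ₗ[ℝ] 𝔤) :=
    (LinearMap.injective_iff_surjective_of_finrank_eq_finrank hd).1 hinj
  exact ⟨(LieEquiv.ofBijective f ⟨hinj, hsurj⟩).symm⟩

end Structure

end CoadjointOrbits

namespace CoadjointOrbits

open Module

/-! ### Cases by the dimension of the derived algebra -/

section Classification

variable {𝔤 : Type*} [LieRing 𝔤] [LieAlgebra ℝ 𝔤] [FiniteDimensional ℝ 𝔤]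

/-- In a Frobenius Lie algebra with one-dimensional derived algebra, a principal element has
trace `1`. -/
theorem trace_ad_of_finrank_eq_one {D : Submodule ℝ 𝔤} (hmem : ∀ X Y : 𝔤, ⁅X, Y⁆ ∈ D)
    (hD : finrank ℝ D = 1) {α : Dual ℝ 𝔤} (hα : ¬ IsClosedForm α) {X : 𝔤}
    (hX : kirillovMap α X = α) : LinearMap.trace ℝ 𝔤 (LieAlgebra.ad ℝ 𝔤 X) = 1 := by
  rw [isClosedForm_iff] at hα
  push Not at hα
  obtain ⟨U, V, hUV⟩ := hα
  let z : D := (α ⁅U, V⁆)⁻¹ • ⟨⁅U, V⁆, hmem U V⟩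
  have hαz : α z = 1 := by simp [z, hUV]
  have hz : z ≠ 0 := fun h => by simp [h] at hαz
  have had : LieAlgebra.ad ℝ 𝔤 X = α.smulRight (z : 𝔤) := by
    refine LinearMap.ext fun Y => ?_
    obtain ⟨c, hc⟩ := (finrank_eq_one_iff_of_nonzero' z hz).1 hD ⟨⁅X, Y⁆, hmem X Y⟩
    have hc' : c • (z : 𝔤) = ⁅X, Y⁆ := congrArg Subtype.val hc
    have h1 : α ⁅X, Y⁆ = α Y := LinearMap.congr_fun hX Y
    rw [← hc', map_smul, hαz, smul_eq_mul, mul_one] at h1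
    rw [LieAlgebra.ad_apply, LinearMap.smulRight_apply, ← hc', h1]
  rw [had, LinearMap.trace_smulRight, hαz]

theorem trace_ad_of_finrank_eq_three {D : Submodule ℝ 𝔤} (hmem : ∀ X Y : 𝔤, ⁅X, Y⁆ ∈ D)
    (hD : finrank ℝ D = 3) (h : ∀ U V : 𝔤, U ≠ 0 → ⁅U, V⁆ = 0 → ∃ c : ℝ, V = c • U) (X : 𝔤) :
    LinearMap.trace ℝ 𝔤 (LieAlgebra.ad ℝ 𝔤 X) = 0 := by
  let L : LieSubalgebra ℝ 𝔤 := { D with lie_mem' := fun _ _ => hmem _ _ }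
  have hL : finrank ℝ L = 3 := hD
  rw [← LinearMap.trace_restrict_eq_of_forall_mem L.toSubmodule (LieAlgebra.ad ℝ 𝔤 X)
    (fun Y => hmem X Y)]
  refine trace_eq_zero_of_derivation (D := L) _ (fun U V => Subtype.ext ?_)
    (finBasisOfFinrankEq ℝ L hL) fun U V hU hUV => ?_
  · exact leibniz_lie X (U : 𝔤) (V : 𝔤)
  · obtain ⟨c, hc⟩ := h U V (by simpa using hU) (congrArg Subtype.val hUV)
    exact ⟨c, Subtype.ext hc⟩

theorem exists_lieEquiv_of_finrank_eq_two (hdim : finrank ℝ 𝔤 = 4) {D : Submodule ℝ 𝔤}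
    (hr : ∀ X : 𝔤, X ≠ 0 → LinearMap.range (LieAlgebra.ad ℝ 𝔤 X) = D) (hD : finrank ℝ D = 2) :
    ∃ lam : ℝ, lam < 0 ∧ Nonempty (𝔤 ≃ₗ⁅ℝ⁆ G4 lam) := by
  have hmem : ∀ X Y : 𝔤, ⁅X, Y⁆ ∈ D := fun X Y => by
    by_cases hX : X = 0
    · simp [hX]
    · rw [← hr X hX]
      exact ⟨Y, rfl⟩
  have hsol : ∀ X V : 𝔤, X ≠ 0 → V ∈ D → ∃ Y, ⁅X, Y⁆ = V := fun X V hX hV => by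
    rwa [← hr X hX] at hV
  obtain ⟨Z, W₀, hZ, hW₀, hspan, hli⟩ : ∃ Z W₀ : 𝔤, Z ∈ D ∧ W₀ ∈ D ∧
      (∀ V ∈ D, ∃ p q : ℝ, V = p • Z + q • W₀) ∧
      ∀ p q : ℝ, p • Z + q • W₀ = 0 → p = 0 ∧ q = 0 := by
    let b := finBasisOfFinrankEq ℝ D hD
    refine ⟨b 0, b 1, (b 0).2, (b 1).2, fun V hV => ⟨b.repr ⟨V, hV⟩ 0, b.repr ⟨V, hV⟩ 1, ?_⟩,
      fun p q h => ?_⟩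
    · have := b.sum_repr ⟨V, hV⟩
      rw [Fin.sum_univ_two] at this
      exact (congrArg Subtype.val this).symm
    · have := Fintype.linearIndependent_iff.1 b.linearIndependent ![p, q]
        (by simpa [Fin.sum_univ_two, Subtype.ext_iff] using h)
      exact ⟨this 0, this 1⟩
  have hZ0 : Z ≠ 0 := fun h => one_ne_zero (hli 1 0 (by simp [h])).1
  have hZW₀ : ⁅Z, W₀⁆ = 0 := by
    by_contra hU
    -- By Jacobi, `ad ⁅Z, W₀⁆` has values in `⁅D, D⁆`, a line; but its range is all of `D`.
    have hm : ∀ V ∈ D, ∃ c : ℝ, V = c • ⁅Z, W₀⁆ := fun V hV => by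
      obtain ⟨Y, rfl⟩ := hsol _ V hU hV
      obtain ⟨p, q, hpq⟩ := hspan _ (hmem W₀ Y)
      obtain ⟨p', q', hpq'⟩ := hspan _ (hmem Z Y)
      refine ⟨q + p', ?_⟩
      rw [lie_lie, hpq, hpq']
      simp only [lie_add, lie_smul, lie_self]
      rw [← lie_skew W₀ Z]
      module
    obtain ⟨c, hc⟩ := hm Z hZ
    obtain ⟨d, hd⟩ := hm W₀ hW₀
    have := hli d (-c) (by
      generalize ⁅Z, W₀⁆ = U at hc hd
      rw [hc, hd]; module)
    rw [neg_eq_zero] at this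
    exact hZ0 (by rw [hc, this.2, zero_smul])
  have hW₀Z : ⁅W₀, Z⁆ = 0 := by rw [← lie_skew, hZW₀, neg_zero]
  have hab : ∀ U ∈ D, ∀ V ∈ D, ⁅U, V⁆ = 0 := fun U hU V hV => by
    obtain ⟨p, q, rfl⟩ := hspan U hU
    obtain ⟨p', q', rfl⟩ := hspan V hV
    simp [hZW₀, hW₀Z]
  obtain ⟨E, hE⟩ := hsol Z (-Z) hZ0 (neg_mem hZ)
  obtain ⟨A₀, hA₀⟩ := hsol Z (-W₀) hZ0 (neg_mem hW₀)
  have hEZ : ⁅E, Z⁆ = Z := by rw [← lie_skew, hE, neg_neg]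
  have hA₀Z : ⁅A₀, Z⁆ = W₀ := by rw [← lie_skew, hA₀, neg_neg]
  have hEW₀ : ⁅E, W₀⁆ = W₀ := by
    rw [← hA₀Z, leibniz_lie, hEZ, hab _ (hmem E A₀) _ hZ, zero_add]
  obtain ⟨p, q, hpq⟩ := hspan _ (hmem A₀ W₀)
  -- `A₀` has trace `q` on `D`; subtracting `(q / 2) • E` makes it traceless, so its square there is
  -- the scalar `p + q ^ 2 / 4`.
  let W := W₀ - (q / 2) • Z
  have hWdef : W = W₀ - (q / 2) • Z := rfl
  have hW : W ∈ D := D.sub_mem hW₀ (D.smul_mem _ hZ)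
  let A₁ := A₀ - (q / 2) • E
  have hA₁def : A₁ = A₀ - (q / 2) • E := rfl
  -- The correction lies in `D`, where `E` is the identity: `A` commutes with `E` and acts on `D` as
  -- `A₁` does.
  let A := A₁ - ⁅E, A₁⁆
  have hAdef : A = A₁ - ⁅E, A₁⁆ := rfl
  have hAD : ∀ V ∈ D, ⁅A, V⁆ = ⁅A₁, V⁆ := fun V hV => by
    rw [hAdef, sub_lie, hab _ (hmem E A₁) _ hV, sub_zero]
  have hED : ∀ V ∈ D, ⁅E, V⁆ = V := fun V hV => by
    obtain ⟨p, q, rfl⟩ := hspan V hV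
    simp [hEZ, hEW₀]
  have hEA : ⁅E, A⁆ = 0 := by rw [hAdef, lie_sub, hED _ (hmem E A₁), sub_self]
  have hAZ : ⁅A, Z⁆ = W := by
    rw [hAD Z hZ, hA₁def, sub_lie, smul_lie, hA₀Z, hEZ]
  have hAW : ⁅A, W⁆ = (p + q ^ 2 / 4) • Z := by
    rw [hAD W hW, hA₁def, sub_lie, smul_lie, hED W hW, hWdef, lie_sub, lie_smul, hA₀Z, hpq]
    module
  have hli' : ∀ p q : ℝ, p • Z + q • W = 0 → p = 0 ∧ q = 0 := fun a b h => by
    obtain ⟨h1, h2⟩ := hli (a - b * (q / 2)) b (by rw [← h, hWdef]; module)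
    subst h2
    simpa using h1
  refine ⟨p + q ^ 2 / 4, ?_,
    nonempty_lieEquiv_G4 hdim hEA (hED W hW) hEZ hAW hAZ (hab W hW Z hZ) hli'⟩
  generalize p + q ^ 2 / 4 = lam at hAW
  by_contra! hlam
  -- `W + s • Z` is an eigenvector of `A` for `s = √lam`, so it commutes with `A - s • E`. Its
  -- centralizer is `D` by dimension, yet `A - s • E` does not commute with `Z`.
  have hs := Real.mul_self_sqrt hlam
  generalize Real.sqrt lam = s at hs
  have hV : W + s • Z ∈ D := D.add_mem hW (D.smul_mem _ hZ)
  have hV0 : W + s • Z ≠ 0 := fun h => one_ne_zero (hli' s 1 (by rw [← h]; module)).2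
  have hUV : ⁅A - s • E, W + s • Z⁆ = 0 := by
    simp only [sub_lie, smul_lie, lie_add, lie_smul, hAW, hAZ, hED W hW, hEZ, ← hs]
    module
  have hker : D = LinearMap.ker (LieAlgebra.ad ℝ 𝔤 (W + s • Z)) := by
    refine Submodule.eq_of_le_of_finrank_eq (fun V hV' => hab _ hV V hV') ?_
    have := LinearMap.finrank_range_add_finrank_ker (LieAlgebra.ad ℝ 𝔤 (W + s • Z))
    rw [hr _ hV0] at this
    omega
  have hU : A - s • E ∈ D := by
    rw [hker, LinearMap.mem_ker, LieAlgebra.ad_apply, ← lie_skew, hUV, neg_zero]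
  have h0 := hab _ hU Z hZ
  rw [sub_lie, smul_lie, hAZ, hEZ] at h0
  exact one_ne_zero (hli' (-s) 1 (by rw [← h0]; module)).2

end Classification

end CoadjointOrbits

open CoadjointOrbits in
theorem mainTheorem7 {𝔤 : Type*} [LieRing 𝔤] [LieAlgebra ℝ 𝔤] [FiniteDimensional ℝ 𝔤]
    (hdim : Module.finrank ℝ 𝔤 = 4)
    (hnonabelian : ¬ IsLieAbelian 𝔤)
    (horbit : ∀ α : Module.Dual ℝ 𝔤, ¬ CoadjointOrbits.IsClosedForm α →
      CoadjointOrbits.CoadjointOrbitHasDim α 4) :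
    ∃ lam : ℝ, lam < 0 ∧ Nonempty (𝔤 ≃ₗ⁅ℝ⁆ CoadjointOrbits.G4 lam) := by
  have hbij : ∀ α : Module.Dual ℝ 𝔤, ¬ IsClosedForm α → Function.Bijective (kirillovMap α) :=
    fun α hα => kirillovMap_bijective (hdim ▸ horbit α hα)
  have hle := fun {X : 𝔤} (hX : X ≠ 0) => range_ad_le_range_ad (fun α hα => (hbij α hα).1) hX
  obtain ⟨X₀, Y₀, hXY⟩ : ∃ X Y : 𝔤, ⁅X, Y⁆ ≠ 0 := by
    by_contra! h
    exact hnonabelian ⟨h⟩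
  have hX₀ : X₀ ≠ 0 := fun h => hXY (by rw [h, zero_lie])
  obtain ⟨α, hα⟩ : ∃ α : Module.Dual ℝ 𝔤, ¬ IsClosedForm α := by
    by_contra! h
    exact hXY ((Module.forall_dual_apply_eq_zero_iff ℝ _).1
      fun α => isClosedForm_iff.1 (h α) X₀ Y₀)
  obtain ⟨P, hP⟩ := (hbij α hα).2 α
  have htr := two_mul_trace_ad (hbij α hα) hP
  let D := LinearMap.range (LieAlgebra.ad ℝ 𝔤 X₀)
  have hr : ∀ X : 𝔤, X ≠ 0 → LinearMap.range (LieAlgebra.ad ℝ 𝔤 X) = D :=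
    fun X hX => (hle hX₀ X).antisymm (hle hX X₀)
  have hmem : ∀ X Y : 𝔤, ⁅X, Y⁆ ∈ D := fun X Y => hle hX₀ X ⟨Y, rfl⟩
  have hpos : 0 < Module.finrank ℝ D :=
    Module.finrank_pos_iff_exists_ne_zero.2
      ⟨⟨⁅X₀, Y₀⁆, hmem _ _⟩, fun h => hXY (congrArg Subtype.val h)⟩
  have hlt : Module.finrank ℝ D < 4 := by
    have h1 : Module.finrank ℝ D + _ = _ :=
      LinearMap.finrank_range_add_finrank_ker (LieAlgebra.ad ℝ 𝔤 X₀)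
    have h2 : 0 < Module.finrank ℝ (LinearMap.ker (LieAlgebra.ad ℝ 𝔤 X₀)) :=
      Module.finrank_pos_iff_exists_ne_zero.2
        ⟨⟨X₀, by simp⟩, fun h => hX₀ (congrArg Subtype.val h)⟩
    omega
  rw [hdim] at htr
  obtain h1 | h2 | h3 : Module.finrank ℝ D = 1 ∨ Module.finrank ℝ D = 2 ∨
      Module.finrank ℝ D = 3 := by omega
  · rw [trace_ad_of_finrank_eq_one hmem h1 hα hP] at htr
    norm_num at htr
  · exact exists_lieEquiv_of_finrank_eq_two hdim hr h2
  · rw [trace_ad_of_finrank_eq_three hmem h3 (fun U V hU =>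
      exists_eq_smul_of_lie_eq_zero hU (by rw [hr U hU, h3, hdim])) P] at htr
    norm_num at htr
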